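/- Theorem. Let $K$ be an algebraically closed field and let $\mathcal C$ be a nonzero abelian $K$-linear category that is Hom-finite (every $\operatorname{Hom}_{\mathcal C}(X,Y)$ is a finite-dimensional $K$-vector space) and Krull–Schmidt (every object is a finite direct sum of objects with local endomorphism rings), and whose Grothendieck group $G=K_0(\mathcal C)$ has finite rank. Here, for an abelian category $\mathcal A$, $K_0(\mathcal A)$ is the abelian group generated by the objects of $\mathcal A$ modulo the relations $[Y]=[X]+[Z]$ for all short exact sequences $0\to X\to Y\to Z\to 0$. Let $\operatorname{End}(\mathcal C)$ be the abelian category of pairs $(X,x)$ with $X\in\mathcal C$ and $x\in\operatorname{End}_{\mathcal C}(X)$, a morphism $(X,x)\to(Y,y)$ being a morphism $f:X\to Y$ in $\mathcal C$ with $fx=yf$; let $\operatorname{Nil}(\mathcal C)$ be its full (abelian) subcategory of pairs $(X,x)$ with $x$ nilpotent. Then: (1) $\operatorname{Nil}(\mathcal C)$ is not semisimple: some object is not a finite direct sum of simple objects, and some short exact sequence does not split. Moreover $\operatorname{Nil}(\mathcal C)$ is of infinite representation type, i.e. it has infinitely many isomorphism classes of indecomposable objects. (2) An object $(X,x)$ of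 $\operatorname{Nil}(\mathcal C)$ is simple if and only if $X$ is simple in $\mathcal C$ and $x=0$, and the embedding $X\mapsto (X,0)$ restricts to an isomorphism from the full subcategory of simple objects of $\mathcal C$ onto the full subcategory of simple objects of $\operatorname{Nil}(\mathcal C)$. (3) $K_0(\operatorname{Nil}(\mathcal C))\cong G$. (4) $K_0(\operatorname{End}(\mathcal C))\cong\bigoplus_{k\in K}G$. -/

import Mathlib

open CategoryTheory CategoryTheory.Limits

universe w v u

/-! ### The endomorphism category -/

/-- Objects of the endomorphism category `End(C)`: pairs `(X, x)` with `x : X ⟶ X`. -/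
structure EndCat (C : Type u) [Category.{v} C] where
  /-- the underlying object -/
  obj : C
  /-- the endomorphism -/
  endo : CategoryTheory.End obj

namespace EndCat

section Basic

variable {C : Type u} [Category.{v} C]

/-- A morphism `(X, x) ⟶ (Y, y)` is a morphism `f : X ⟶ Y` with `f ∘ x = y ∘ f`. -/
@[ext]
structure Hom (X Y : EndCat C) where
  /-- the underlying morphism -/
  f : X.obj ⟶ Y.obj
  comm : X.endo ≫ f = f ≫ Y.endo

instance : Category.{v} (EndCat C) where
  Hom X Y := Hom X Y
  id X := ⟨𝟙 X.obj, by simp⟩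
  comp g h := ⟨g.f ≫ h.f, by
    rw [← Category.assoc, g.comm, Category.assoc, h.comm, Category.assoc]⟩
  id_comp g := Hom.ext (Category.id_comp g.f)
  comp_id g := Hom.ext (Category.comp_id g.f)
  assoc g h k := Hom.ext (Category.assoc g.f h.f k.f)

@[ext]
theorem hom_ext {X Y : EndCat C} {g h : X ⟶ Y} (e : g.f = h.f) : g = h := Hom.ext e

@[simp] theorem id_f (X : EndCat C) : Hom.f (𝟙 X) = 𝟙 X.obj := rfl

@[simp] theorem comp_f {X Y Z : EndCat C} (g : X ⟶ Y) (h : Y ⟶ Z) :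
    (g ≫ h).f = g.f ≫ h.f := rfl

/-- The endomorphism `x`, regarded as an endomorphism of `(X, x)`. -/
def self (X : EndCat C) : CategoryTheory.End X := ⟨X.endo, rfl⟩

theorem self_naturality {X Y : EndCat C} (g : X ⟶ Y) : X.self ≫ g = g ≫ Y.self :=
  hom_ext g.comm

theorem self_pow_naturality {X Y : EndCat C} (g : X ⟶ Y) (n : ℕ) :
    (X.self ^ n : CategoryTheory.End X) ≫ g = g ≫ (Y.self ^ n : CategoryTheory.End Y) := by
  induction n with
  | zero => simp [End.one_def]
  | succ n ih =>
    rw [pow_succ, pow_succ, End.mul_def, End.mul_def, Category.assoc, ih, ← Category.assoc,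
      self_naturality, Category.assoc]

theorem pow_f {X : EndCat C} (g : CategoryTheory.End X) (n : ℕ) :
    Hom.f (g ^ n : CategoryTheory.End X) = ((show CategoryTheory.End X.obj from Hom.f g) ^ n : CategoryTheory.End X.obj) := by
  induction n with
  | zero => rfl
  | succ n ih => rw [pow_succ, pow_succ, End.mul_def, End.mul_def, comp_f, ih]

end Basic

section Preadditive

variable {C : Type u} [Category.{v} C] [Preadditive C]

instance (X Y : EndCat C) : Zero (X ⟶ Y) := ⟨⟨0, by simp⟩⟩

instance (X Y : EndCat C) : Add (X ⟶ Y) :=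
  ⟨fun g h => ⟨g.f + h.f, by
    rw [Preadditive.comp_add, Preadditive.add_comp, g.comm, h.comm]⟩⟩

instance (X Y : EndCat C) : Neg (X ⟶ Y) :=
  ⟨fun g => ⟨-g.f, by rw [Preadditive.comp_neg, Preadditive.neg_comp, g.comm]⟩⟩

instance (X Y : EndCat C) : Sub (X ⟶ Y) :=
  ⟨fun g h => ⟨g.f - h.f, by
    rw [Preadditive.comp_sub, Preadditive.sub_comp, g.comm, h.comm]⟩⟩

instance (X Y : EndCat C) : SMul ℕ (X ⟶ Y) :=
  ⟨fun n g => ⟨n • g.f, by rw [Preadditive.comp_nsmul, Preadditive.nsmul_comp, g.comm]⟩⟩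

instance (X Y : EndCat C) : SMul ℤ (X ⟶ Y) :=
  ⟨fun n g => ⟨n • g.f, by rw [Preadditive.comp_zsmul, Preadditive.zsmul_comp, g.comm]⟩⟩

instance : Preadditive (EndCat C) where
  homGroup X Y := Function.Injective.addCommGroup (fun g : X ⟶ Y => g.f)
    (fun _ _ => hom_ext) rfl (fun _ _ => rfl) (fun _ => rfl) (fun _ _ => rfl)
    (fun _ _ => rfl) (fun _ _ => rfl)
  add_comp _ _ _ g g' h := hom_ext (Preadditive.add_comp _ _ _ g.f g'.f h.f)
  comp_add _ _ _ g h h' := hom_ext (Preadditive.comp_add _ _ _ g.f h.f h'.f)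

@[simp] theorem zero_f (X Y : EndCat C) : Hom.f (0 : X ⟶ Y) = 0 := rfl

@[simp] theorem add_f {X Y : EndCat C} (g h : X ⟶ Y) : (g + h).f = g.f + h.f := rfl

end Preadditive

section Abelian

variable (C : Type u) [Category.{v} C]

/-- `End(C)` viewed inside the functor category `ℕ ⥤ C` (`ℕ` the one-object category). -/
def toFunctor : EndCat C ⥤ SingleObj (Multiplicative ℕ) ⥤ C where
  obj X := SingleObj.functor (powersHom (CategoryTheory.End X.obj) X.endo)
  map {X Y} g := SingleObj.natTrans g.f fun a => by
    have h := congrArg Hom.f (self_pow_naturality g a.toAdd)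
    rw [comp_f, comp_f, pow_f, pow_f] at h
    exact h
  map_id _ := rfl
  map_comp _ _ := rfl

instance : (toFunctor C).Faithful where
  map_injective {_ _ _ _} e := hom_ext (NatTrans.congr_app e (SingleObj.star _))

instance : (toFunctor C).Full where
  map_surjective {X Y} α := by
    refine ⟨⟨α.app (SingleObj.star _), ?_⟩, rfl⟩
    have h := α.naturality (X := SingleObj.star _) (Y := SingleObj.star _)
      (Multiplicative.ofAdd 1 : Multiplicative ℕ)
    have e : ∀ Z : EndCat C, ((toFunctor C).obj Z).map (X := SingleObj.star _)
        (Y := SingleObj.star _) (Multiplicative.ofAdd 1 : Multiplicative ℕ) = Z.endo :=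
      fun Z => pow_one (M := CategoryTheory.End Z.obj) Z.endo
    rw [e, e] at h
    exact h

instance : (toFunctor C).EssSurj where
  mem_essImage F := by
    let X : EndCat C := ⟨F.obj (SingleObj.star _),
      F.map (X := SingleObj.star _) (Y := SingleObj.star _)
        (Multiplicative.ofAdd 1 : Multiplicative ℕ)⟩
    refine ⟨X, ⟨NatIso.ofComponents (fun _ => Iso.refl _) ?_⟩⟩
    rintro ⟨⟩ ⟨⟩ (a : Multiplicative ℕ)
    have key : ∀ n : ℕ, ((X.endo ^ n : CategoryTheory.End X.obj) : X.obj ⟶ X.obj) =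
        F.map (X := SingleObj.star _) (Y := SingleObj.star _)
          (Multiplicative.ofAdd n : Multiplicative ℕ) := by
      intro n
      induction n with
      | zero => exact (F.map_id (SingleObj.star _)).symm
      | succ n ih =>
        rw [pow_succ, End.mul_def, ih]
        exact (F.map_comp (X := SingleObj.star _) (Y := SingleObj.star _)
          (Z := SingleObj.star _) _ _).symm
    exact (Category.comp_id _).trans ((key a.toAdd).trans (Category.id_comp _).symm)

instance : (toFunctor C).IsEquivalence where

variable [Abelian C]

noncomputable instance : Abelian (EndCat C) :=
  haveI : HasFiniteProducts (EndCat C) := ⟨fun _ =>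
    Adjunction.hasLimitsOfShape_of_equivalence (toFunctor C)⟩
  abelianOfEquivalence (toFunctor C)

end Abelian

end EndCat

/-! ### The nilpotent category -/

/-- The pairs `(X, x)` with `x` nilpotent. -/
def EndCat.isNil (C : Type u) [Category.{v} C] [Preadditive C] : ObjectProperty (EndCat C) :=
  fun X => IsNilpotent X.endo

/-- The nilpotent category `Nil(C)`: the full subcategory of `End(C)` of all nilpotent
endomorphisms. -/
abbrev NilCat (C : Type u) [Category.{v} C] [Preadditive C] : Type (max u v) :=
  (EndCat.isNil C).FullSubcategory

namespace NilCat

section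

variable {C : Type u} [Category.{v} C] [Preadditive C]

theorem isNil_iff (X : EndCat C) : EndCat.isNil C X ↔ ∃ n : ℕ, X.self ^ n = 0 := by
  refine exists_congr fun n => ⟨fun h => ?_, fun h => ?_⟩
  · apply EndCat.hom_ext
    rw [EndCat.pow_f]
    exact h
  · have := congrArg EndCat.Hom.f h
    rw [EndCat.pow_f] at this
    exact this

instance : (EndCat.isNil C).IsClosedUnderSubobjects where
  prop_of_mono {X Y} i _ hY := by
    obtain ⟨n, hn⟩ := (isNil_iff Y).1 hY
    refine (isNil_iff X).2 ⟨n, ?_⟩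
    rw [← cancel_mono i]
    exact (EndCat.self_pow_naturality i n).trans (by rw [hn, comp_zero, zero_comp])

instance : (EndCat.isNil C).IsClosedUnderQuotients where
  prop_of_epi {X Y} p _ hX := by
    obtain ⟨n, hn⟩ := (isNil_iff X).1 hX
    refine (isNil_iff Y).2 ⟨n, ?_⟩
    rw [← cancel_epi p]
    exact (EndCat.self_pow_naturality p n).symm.trans (by rw [hn, comp_zero, zero_comp])

instance : (EndCat.isNil C).IsClosedUnderBinaryProducts where
  limitsOfShape_le := by
    rintro X ⟨p⟩
    obtain ⟨m, hm⟩ := (isNil_iff _).1 (p.prop_diag_obj ⟨WalkingPair.left⟩)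
    obtain ⟨n, hn⟩ := (isNil_iff _).1 (p.prop_diag_obj ⟨WalkingPair.right⟩)
    refine (isNil_iff X).2 ⟨m + n, p.isLimit.hom_ext ?_⟩
    rintro ⟨_ | _⟩
    · refine (EndCat.self_pow_naturality _ _).trans ?_
      rw [pow_add, hm, zero_mul]
      exact comp_zero.trans zero_comp.symm
    · refine (EndCat.self_pow_naturality _ _).trans ?_
      rw [pow_add, hn, mul_zero]
      exact comp_zero.trans zero_comp.symm

end

section

variable (C : Type u) [Category.{v} C] [Abelian C]

instance : (EndCat.isNil C).ContainsZero where
  exists_zero := by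
    have : HasZeroObject (EndCat C) := Abelian.hasZeroObject
    obtain ⟨Z, hZ⟩ := this.zero
    exact ⟨Z, hZ, (isNil_iff Z).2 ⟨1, hZ.eq_of_src _ _⟩⟩

instance : (EndCat.isNil C).IsClosedUnderFiniteProducts :=
  ObjectProperty.IsClosedUnderFiniteProducts.mk'

/-- The embedding `C ⥤ Nil(C)`, `X ↦ (X, 0)`. -/
def zeroFunctor : C ⥤ NilCat C where
  obj X := ⟨⟨X, 0⟩, IsNilpotent.zero⟩
  map {X Y} f := ObjectProperty.homMk
    (⟨f, zero_comp.trans comp_zero.symm⟩ : (⟨X, 0⟩ : EndCat C) ⟶ ⟨Y, 0⟩)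

end

end NilCat

/-! ### Notions for abelian categories -/

/-- The subgroup of the free abelian group on the objects of `A` generated by the elements
`[Y] - [X] - [Z]` for the short exact sequences `0 ⟶ X ⟶ Y ⟶ Z ⟶ 0`. -/
def exactRelations (A : Type u) [Category.{v} A] [Abelian A] : AddSubgroup (FreeAbelianGroup A) :=
  AddSubgroup.closure {r | ∃ S : ShortComplex A, S.ShortExact ∧
    r = FreeAbelianGroup.of S.X₂ - FreeAbelianGroup.of S.X₁ - FreeAbelianGroup.of S.X₃}

/-- The Grothendieck group of an abelian category. -/
abbrev K0 (A : Type u) [Category.{v} A] [Abelian A] : Type u :=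
  FreeAbelianGroup A ⧸ exactRelations A

section

attribute [local instance] Abelian.hasFiniteBiproducts

/-- `A` is Krull–Schmidt: every object is a finite direct sum of objects with local
endomorphism rings. -/
def IsKrullSchmidt (A : Type u) [Category.{v} A] [Abelian A] : Prop :=
  ∀ X : A, ∃ (n : ℕ) (Y : Fin n → A),
    (∀ i, IsLocalRing (CategoryTheory.End (Y i))) ∧ Nonempty (X ≅ biproduct Y)

/-- `A` is semisimple: every object is a finite direct sum of simple objects. -/
def IsSemisimpleCat (A : Type u) [Category.{v} A] [Abelian A] : Prop :=
  ∀ X : A, ∃ (n : ℕ) (S : Fin n → A), (∀ i, Simple (S i)) ∧ Nonempty (X ≅ biproduct S)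

end

/-- Every short exact sequence in `A` splits. -/
def AllShortExactSplit (A : Type u) [Category.{v} A] [Abelian A] : Prop :=
  ∀ S : ShortComplex A, S.ShortExact → Nonempty S.Splitting

/-- `A` is of infinite representation type: it has infinitely many isomorphism classes of
indecomposable objects. -/
def IsOfInfiniteRepType (A : Type u) [Category.{v} A] [Abelian A] : Prop :=
  {c : Quotient (isIsomorphicSetoid A) |
    ∃ X : A, Indecomposable X ∧ Quotient.mk (isIsomorphicSetoid A) X = c}.Infinite

/-- The property of being a simple object. -/
def simpleObjects (A : Type u) [Category.{v} A] [Abelian A] : ObjectProperty A :=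
  fun X => Simple X

/-- The functor `F` is an isomorphism of categories (with a strict inverse). -/
def IsCatIso {A : Type*} [Category* A] {B : Type*} [Category* B] (F : A ⥤ B) : Prop :=
  ∃ G : B ⥤ A, F ⋙ G = 𝟭 A ∧ G ⋙ F = 𝟭 B

/-!
An object `(X, x)` of `End(C)` or `Nil(C)` carries its endomorphism `x` as a central endomorphism,
that is, as the component of an endomorphism of the identity functor (`EndCat.selfSub`,
`NilCat.selfNat`). Everything follows from this naturality.

On a simple object of `Nil(C)` the nilpotent endomorphism `x` cannot be invertible, so it is zero;
hence the simple objects are the `(X, 0)` with `X` simple (`NilCat.simple_iff`), and every direct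
sum of simple objects has zero endomorphism. On the other hand, for `X ≠ 0` the construction
`NilCat.double`, which replaces `(X, x)` by a square root of `x ⊕ x` on `X ⊕ X`, gives nilpotent
endomorphisms of arbitrarily large index. Applied to `x = 0` it gives an object whose extension
`0 ⟶ kernel ⟶ X ⊕ X ⟶ image ⟶ 0` does not split. Among the objects with `x ^ n ≠ 0`, one whose
endomorphism algebra in `C` has least dimension is indecomposable; as the index is an isomorphism
invariant, there are infinitely many indecomposable objects.

For the Grothendieck groups, dévissage (`K0.cls_mem_of_prod_app_eq_zero`) shows that the class of an
object killed by a product of central endomorphisms `θ k` is a sum of classes of objects killed by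
single factors: split off the kernel of one factor and continue with its image. With powers of `x`
this shows that `K₀(C) ⟶ K₀(Nil(C))`, `[X] ↦ [(X, 0)]`, is surjective, and the forgetful functor
shows that it is injective. With the factors `x - k` of a minimal polynomial it shows that
`⨁ₖ K₀(C) ⟶ K₀(End(C))`, `[X]ₖ ↦ [(X, k)]`, is surjective. For injectivity, the generalized
eigenspace of `x` for `k` is the image of the Fitting idempotent of `x - k`. These idempotents are
natural (`IsFittingIdempotent.naturality`), so generalized eigenspaces form a functor which is a
retract of the forgetful functor and therefore exact; it sends `(X, k)` to `X`, and `(X, l)` to zero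
for `l ≠ k`.
-/

/-! ### Grothendieck groups -/

namespace CategoryTheory.ShortComplex

variable {A : Type u} [Category.{v} A] [Abelian A] {X Y : A}

/-- The sequence `0 ⟶ kernel g ⟶ X ⟶ image g ⟶ 0` of a morphism `g : X ⟶ Y`. -/
noncomputable def kernelImage (g : X ⟶ Y) : ShortComplex A where
  f := kernel.ι g
  g := Abelian.factorThruImage g
  zero := by
    rw [← cancel_mono (Abelian.image.ι g), Category.assoc, Abelian.image.fac,
      kernel.condition, zero_comp]

theorem kernelImage_shortExact (g : X ⟶ Y) : (kernelImage g).ShortExact where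
  exact := by
    have : Mono (kernelImage g).f := inferInstanceAs (Mono (kernel.ι g))
    refine ShortComplex.exact_of_f_is_kernel _ (KernelFork.IsLimit.ofι' _ _
      fun {W} (t : W ⟶ X) (ht : t ≫ Abelian.factorThruImage g = 0) => ?_)
    refine ⟨kernel.lift g t ?_, kernel.lift_ι _ _ _⟩
    rw [← Abelian.image.fac g, ← Category.assoc, ht, zero_comp]
  mono_f := inferInstanceAs (Mono (kernel.ι g))
  epi_g := inferInstanceAs (Epi (Abelian.factorThruImage g))

end CategoryTheory.ShortComplex

namespace K0

section

open scoped ZeroObject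

variable {A : Type u} [Category.{v} A] [Abelian A]

/-- The class of an object in the Grothendieck group. -/
def cls (X : A) : K0 A := QuotientAddGroup.mk (FreeAbelianGroup.of X)

theorem cls_shortExact {S : ShortComplex A} (hS : S.ShortExact) :
    cls S.X₂ = cls S.X₁ + cls S.X₃ := by
  rw [← sub_eq_zero, ← sub_sub]
  exact (QuotientAddGroup.eq_zero_iff _).2 (AddSubgroup.subset_closure ⟨S, hS, rfl⟩)

/-- The universal property of the Grothendieck group: a function on objects which is additive on
short exact sequences induces a homomorphism. -/
def lift {G : Type*} [AddCommGroup G] (f : A → G)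
    (hf : ∀ S : ShortComplex A, S.ShortExact → f S.X₂ = f S.X₁ + f S.X₃) : K0 A →+ G :=
  QuotientAddGroup.lift _ (FreeAbelianGroup.lift f) <| by
    rw [exactRelations, AddSubgroup.closure_le]
    rintro _ ⟨S, hS, rfl⟩
    simp [hf S hS]

@[simp]
theorem lift_cls {G : Type*} [AddCommGroup G] (f : A → G)
    (hf : ∀ S : ShortComplex A, S.ShortExact → f S.X₂ = f S.X₁ + f S.X₃) (X : A) :
    lift f hf (cls X) = f X :=
  (QuotientAddGroup.lift_mk' _ _ _).trans (FreeAbelianGroup.lift_apply_of _ _)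

@[ext]
theorem hom_ext {G : Type*} [AddCommGroup G] {φ ψ : K0 A →+ G}
    (h : ∀ X, φ (cls X) = ψ (cls X)) : φ = ψ :=
  QuotientAddGroup.addMonoidHom_ext _ (FreeAbelianGroup.lift_ext _ _ h)

theorem eq_top_of_cls_mem {H : AddSubgroup (K0 A)} (h : ∀ X : A, cls X ∈ H) : H = ⊤ := by
  have : QuotientAddGroup.mk' H = 0 :=
    hom_ext fun X => (QuotientAddGroup.eq_zero_iff _).2 (h X)
  rw [← QuotientAddGroup.ker_mk' H, this, AddMonoidHom.ker_zero]

theorem cls_eq_zero {X : A} (hX : IsZero X) : cls X = 0 := by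
  have hS : (ShortComplex.mk (𝟙 X) (𝟙 X) (hX.eq_of_src _ _)).ShortExact :=
    { exact := ShortComplex.exact_of_isZero_X₂ _ hX
      mono_f := inferInstanceAs (Mono (𝟙 X))
      epi_g := inferInstanceAs (Epi (𝟙 X)) }
  simpa using cls_shortExact hS

theorem cls_eq_of_iso {X Y : A} (e : X ≅ Y) : cls X = cls Y := by
  have hS : (ShortComplex.mk e.hom (0 : Y ⟶ 0) comp_zero).ShortExact :=
    { exact := (ShortComplex.exact_iff_epi _ rfl).2 (inferInstanceAs (Epi e.hom))
      mono_f := inferInstanceAs (Mono e.hom)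
      epi_g := inferInstanceAs (Epi (0 : Y ⟶ 0)) }
  have := cls_shortExact hS
  rw [cls_eq_zero (isZero_zero A), add_zero] at this
  exact this.symm

/-- Dévissage along central endomorphisms: let `θ k` be endomorphisms of the identity functor.
If `H` contains the class of every object killed by some `θ k`, then it contains the class of every
object killed by a product of the `θ k`. -/
theorem cls_mem_of_prod_app_eq_zero {ι : Type*} (θ : ι → CategoryTheory.End (𝟭 A))
    (H : AddSubgroup (K0 A)) (hH : ∀ k Y, (θ k).app Y = 0 → cls Y ∈ H) :
    ∀ (l : List ι) (X : A), NatTrans.app (l.map θ).prod X = 0 → cls X ∈ H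
  | [], X, h => by
    rw [cls_eq_zero ((IsZero.iff_id_eq_zero X).2 h)]
    exact H.zero_mem
  | k :: l, X, h => by
    -- `X` is an extension of the image of `θ k`, killed by the remaining factors, by its kernel.
    let g : X ⟶ X := (θ k).app X
    have hg : NatTrans.app (l.map θ).prod X ≫ g = 0 := by
      simpa [List.map_cons, List.prod_cons, End.mul_def] using h
    have hK : (θ k).app (kernel g) = 0 := by
      rw [← cancel_mono (kernel.ι g), zero_comp]
      exact ((θ k).naturality (kernel.ι g)).symm.trans (kernel.condition g)
    have hI : NatTrans.app (l.map θ).prod (Abelian.image g) = 0 := by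
      rw [← cancel_epi (Abelian.factorThruImage g), comp_zero]
      refine (NatTrans.naturality (l.map θ).prod (Abelian.factorThruImage g)).trans ?_
      rw [← cancel_mono (Abelian.image.ι g), zero_comp, ← hg]
      exact (Category.assoc _ _ _).trans (congrArg _ (Abelian.image.fac g))
    have hX := cls_shortExact (ShortComplex.kernelImage_shortExact g)
    exact hX ▸ H.add_mem (hH k _ hK) (cls_mem_of_prod_app_eq_zero θ H hH l _ hI)

end

section Map

universe v' u'

variable {A : Type u} [Category.{v} A] [Abelian A] {B : Type u'} [Category.{v'} B] [Abelian B]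

/-- The homomorphism of Grothendieck groups induced by a functor that preserves short exact
sequences. -/
def map (F : A ⥤ B) [F.PreservesZeroMorphisms]
    (hF : ∀ S : ShortComplex A, S.ShortExact → (S.map F).ShortExact) : K0 A →+ K0 B :=
  lift (fun X => cls (F.obj X)) fun S hS => cls_shortExact (hF S hS)

@[simp]
theorem map_cls (F : A ⥤ B) [F.PreservesZeroMorphisms]
    (hF : ∀ S : ShortComplex A, S.ShortExact → (S.map F).ShortExact) (X : A) :
    map F hF (cls X) = cls (F.obj X) := lift_cls _ _ X

end Map

end K0

/-! ### Retracts and sections of exact functors -/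

namespace CategoryTheory

theorem ShortComplex.ShortExact.of_retract {A : Type u} [Category.{v} A] [Abelian A]
    {S T : ShortComplex A} (r : Retract T S) (hS : S.ShortExact) : T.ShortExact where
  exact := by
    have hH := (ShortComplex.exact_iff_isZero_homology S).1 hS.exact
    refine (ShortComplex.exact_iff_isZero_homology T).2 ((IsZero.iff_id_eq_zero _).2 ?_)
    rw [← ShortComplex.homologyMap_id, ← r.retract, ShortComplex.homologyMap_comp,
      hH.eq_of_tgt (ShortComplex.homologyMap r.i) 0, zero_comp]
  mono_f := by
    have := hS.mono_f
    have h1 : r.i.τ₁ ≫ r.r.τ₁ = 𝟙 _ := congrArg ShortComplex.Hom.τ₁ r.retract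
    have : Mono r.i.τ₁ := mono_of_mono_fac h1
    have : Mono (T.f ≫ r.i.τ₂) := by rw [← r.i.comm₁₂]; exact mono_comp _ _
    exact mono_of_mono _ r.i.τ₂
  epi_g := by
    have := hS.epi_g
    have h3 : r.i.τ₃ ≫ r.r.τ₃ = 𝟙 _ := congrArg ShortComplex.Hom.τ₃ r.retract
    have : Epi r.r.τ₃ := epi_of_epi_fac h3
    have : Epi (r.r.τ₂ ≫ T.g) := by rw [r.r.comm₂₃]; exact epi_comp _ _
    exact epi_of_epi r.r.τ₂ _

/-- A faithful exact functor reflects short exact sequences. -/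
theorem ShortComplex.ShortExact.of_map {A B : Type*} [Category* A] [Abelian A] [Category* B]
    [Abelian B] (F : A ⥤ B) [F.Additive] [PreservesFiniteLimits F] [PreservesFiniteColimits F]
    [F.Faithful] {S : ShortComplex A} (hS : (S.map F).ShortExact) : S.ShortExact where
  exact := (ShortComplex.exact_map_iff_of_faithful S F).1 hS.exact
  mono_f := F.mono_of_mono_map hS.mono_f
  epi_g := F.epi_of_epi_map hS.epi_g

end CategoryTheory

/-! ### Forgetful functors -/

namespace EndCat

section

variable (C : Type u) [Category.{v} C]

/-- The forgetful functor `End(C) ⥤ C`, `(X, x) ↦ X`. -/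
def forget : EndCat C ⥤ C where
  obj X := X.obj
  map g := g.f

instance : (forget C).Faithful where
  map_injective e := hom_ext e

variable [Abelian C]

instance : (forget C).Additive where

instance : PreservesFiniteLimits (forget C) :=
  inferInstanceAs (PreservesFiniteLimits
    (toFunctor C ⋙ (evaluation (SingleObj (Multiplicative ℕ)) C).obj (SingleObj.star _)))

instance : PreservesFiniteColimits (forget C) :=
  inferInstanceAs (PreservesFiniteColimits
    (toFunctor C ⋙ (evaluation (SingleObj (Multiplicative ℕ)) C).obj (SingleObj.star _)))

end

end EndCat

namespace NilCat

section

variable (C : Type u) [Category.{v} C] [Abelian C]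

instance : PreservesFiniteLimits (EndCat.isNil C).ι :=
  have := (EndCat.isNil C).preservesKernels_ι
  Functor.preservesFiniteLimits_of_preservesKernels _

instance : PreservesFiniteColimits (EndCat.isNil C).ι :=
  have := (EndCat.isNil C).preservesCokernels_ι
  Functor.preservesFiniteColimits_of_preservesCokernels _

/-- The forgetful functor `Nil(C) ⥤ C`, `(X, x) ↦ X`. -/
abbrev forget : NilCat C ⥤ C := (EndCat.isNil C).ι ⋙ EndCat.forget C

instance : PreservesFiniteLimits (forget C) := comp_preservesFiniteLimits _ _

instance : PreservesFiniteColimits (forget C) := comp_preservesFiniteColimits _ _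

/-- The endomorphism `x` of the objects `(X, x)`, as an endomorphism of the identity functor. -/
def selfNat : CategoryTheory.End (𝟭 (NilCat C)) where
  app X := ObjectProperty.homMk X.obj.self
  naturality _ _ g := by
    ext : 1
    exact (EndCat.self_naturality g.hom).symm

variable {C}

theorem selfNat_pow_app_f (X : NilCat C) (n : ℕ) :
    (NatTrans.app (selfNat C ^ n) X).hom.f = (X.obj.endo ^ n : CategoryTheory.End X.obj.obj) := by
  induction n with
  | zero => rfl
  | succ n ih =>
    rw [pow_succ, pow_succ, End.mul_def, End.mul_def, ← ih]
    rfl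

theorem selfNat_pow_app_eq_zero_iff (X : NilCat C) (n : ℕ) :
    NatTrans.app (selfNat C ^ n) X = 0 ↔ X.obj.endo ^ n = 0 := by
  rw [← (forget C).map_eq_zero_iff]
  exact Eq.congr_left (selfNat_pow_app_f X n)

theorem selfNat_app_eq_zero_iff (X : NilCat C) :
    (selfNat C).app X = 0 ↔ X.obj.endo = 0 := by
  simpa using selfNat_pow_app_eq_zero_iff X 1

theorem isZero_iff (X : NilCat C) : IsZero X ↔ IsZero X.obj.obj := by
  rw [IsZero.iff_id_eq_zero, IsZero.iff_id_eq_zero, ← (forget C).map_eq_zero_iff]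
  rfl

end

end NilCat

/-! ### Simple objects of the nilpotent category -/

namespace NilCat

section

variable {C : Type u} [Category.{v} C] [Abelian C]

/-- An endomorphism of a simple object is zero or invertible, so a nilpotent one is zero. -/
theorem endo_eq_zero_of_simple (X : NilCat C) [Simple X] : X.obj.endo = 0 := by
  rw [← selfNat_app_eq_zero_iff]
  by_contra h
  have hiso : IsIso ((selfNat C).app X) := isIso_of_hom_simple (X := X) (Y := X) h
  obtain ⟨n, hn⟩ := X.property
  have hpow : ∀ m : ℕ, IsIso (NatTrans.app (selfNat C ^ m) X) := by
    intro m
    induction m with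
    | zero => exact inferInstanceAs (IsIso (𝟙 X))
    | succ m ih =>
      rw [pow_succ, End.mul_def]
      exact inferInstanceAs (IsIso ((selfNat C).app X ≫ NatTrans.app (selfNat C ^ m) X))
  have hz := hpow n
  rw [(selfNat_pow_app_eq_zero_iff X n).2 hn] at hz
  exact id_nonzero X ((IsIso.inv_hom_id (0 : X ⟶ X)).symm.trans comp_zero)

theorem simple_iff (X : NilCat C) : Simple X ↔ Simple X.obj.obj ∧ X.obj.endo = 0 := by
  constructor
  · intro hX
    have h0 := endo_eq_zero_of_simple X
    refine ⟨⟨fun {Y} f hf => ?_⟩, h0⟩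
    let f' : (zeroFunctor C).obj Y ⟶ X := ObjectProperty.homMk
      (⟨f, by rw [h0]; exact zero_comp.trans comp_zero.symm⟩ : (⟨Y, 0⟩ : EndCat C) ⟶ X.obj)
    have : Mono f' := (forget C).mono_of_mono_map hf
    have h1 : IsIso f' ↔ IsIso f := (isIso_iff_of_reflects_iso f' (forget C)).symm
    have h2 : f' = 0 ↔ f = 0 := ((forget C).map_eq_zero_iff (f := f')).symm
    rw [← h1, Ne, ← h2]
    exact Simple.mono_isIso_iff_nonzero f'
  · rintro ⟨hX, -⟩
    have : Simple ((forget C).obj X) := hX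
    exact (forget C).simple_of_simple_obj X

variable (C) in
/-- The embedding `X ↦ (X, 0)`, restricted to simple objects. -/
def simpleFunctor :
    (simpleObjects C).FullSubcategory ⥤ (simpleObjects (NilCat C)).FullSubcategory :=
  (simpleObjects (NilCat C)).lift ((simpleObjects C).ι ⋙ zeroFunctor C)
    fun X => (simple_iff _).2 ⟨X.property, rfl⟩

variable (C) in
/-- The forgetful functor, restricted to simple objects. -/
def simpleForget :
    (simpleObjects (NilCat C)).FullSubcategory ⥤ (simpleObjects C).FullSubcategory :=
  (simpleObjects C).lift ((simpleObjects (NilCat C)).ι ⋙ forget C)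
    fun X => ((simple_iff _).1 X.property).1

theorem isCatIso_simpleFunctor : IsCatIso (simpleFunctor C) := by
  refine ⟨simpleForget C, rfl, ?_⟩
  have hobj : ∀ X, (simpleForget C ⋙ simpleFunctor C).obj X = X := by
    rintro ⟨⟨⟨X, x⟩, hx⟩, hX⟩
    obtain rfl : x = 0 := ((simple_iff _).1 hX).2
    rfl
  refine Functor.hext hobj ?_
  rintro ⟨⟨⟨X, x⟩, hx⟩, hX⟩ ⟨⟨⟨Y, y⟩, hy⟩, hY⟩ f
  obtain rfl : x = 0 := ((simple_iff _).1 hX).2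
  obtain rfl : y = 0 := ((simple_iff _).1 hY).2
  rfl

end

end NilCat

/-! ### Non-semisimplicity and infinite representation type -/

namespace NilCat

section

variable {C : Type u} [Category.{v} C] [Abelian C]

theorem biprod_map_zero {X Y : C} : biprod.map (0 : X ⟶ X) (0 : Y ⟶ Y) = 0 := by
  apply biprod.hom_ext' <;> simp

/-- The matrix `y = (0 x; 1 0)` on `X ⊕ X` satisfies `y ^ (2 * n) = x ^ n ⊕ x ^ n`. -/
theorem desc_inr_inl_pow_two_mul (X : EndCat C) (n : ℕ) :
    let y : CategoryTheory.End (X.obj ⊞ X.obj) :=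
      biprod.desc biprod.inr ((X.endo : X.obj ⟶ X.obj) ≫ biprod.inl)
    (y ^ (2 * n) : CategoryTheory.End (X.obj ⊞ X.obj)) =
      biprod.map (X.endo ^ n : CategoryTheory.End X.obj)
        (X.endo ^ n : CategoryTheory.End X.obj) := by
  intro y
  induction n with
  | zero => exact biprod.hom_ext' _ _ (by simp [End.one_def]) (by simp [End.one_def])
  | succ n ih =>
    rw [mul_add, mul_one, pow_add, ih, pow_two, pow_succ, End.mul_def, End.mul_def, End.mul_def]
    apply biprod.hom_ext' <;> simp [y]

/-- The object `(X ⊕ X, y)` with `y (a, b) = (x b, a)`, a square root of `(X ⊕ X, x ⊕ x)`. -/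
noncomputable def double (X : NilCat C) : NilCat C :=
  ⟨⟨X.obj.obj ⊞ X.obj.obj,
    biprod.desc biprod.inr ((X.obj.endo : X.obj.obj ⟶ X.obj.obj) ≫ biprod.inl)⟩, by
    obtain ⟨n, hn⟩ := X.property
    refine ⟨2 * n, (desc_inr_inl_pow_two_mul X.obj n).trans ?_⟩
    rw [hn]
    exact biprod_map_zero⟩

theorem double_endo_pow (X : NilCat C) (n : ℕ) :
    ((double X).obj.endo ^ (2 * n) : CategoryTheory.End (X.obj.obj ⊞ X.obj.obj)) =
      biprod.map (X.obj.endo ^ n : CategoryTheory.End X.obj.obj)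
        (X.obj.endo ^ n : CategoryTheory.End X.obj.obj) :=
  desc_inr_inl_pow_two_mul X.obj n

theorem double_endo_pow_ne_zero (X : NilCat C) {n : ℕ} (h : X.obj.endo ^ n ≠ 0) :
    (double X).obj.endo ^ (2 * n + 1) ≠ 0 := by
  intro h0
  apply h
  rw [pow_succ', End.mul_def, double_endo_pow] at h0
  have hX : biprod.inl ≫ (biprod.map (X.obj.endo ^ n : CategoryTheory.End X.obj.obj)
      (X.obj.endo ^ n : CategoryTheory.End X.obj.obj) ≫ (double X).obj.endo) ≫ biprod.snd =
      X.obj.endo ^ n := by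
    simp [double]
  refine hX.symm.trans ((congrArg (fun t => biprod.inl ≫ t ≫ biprod.snd) h0).trans ?_)
  exact (congrArg (biprod.inl ≫ ·) zero_comp).trans comp_zero

/-- There are nilpotent endomorphisms of arbitrarily large nilpotency index. -/
theorem exists_endo_pow_ne_zero {X : C} (hX : ¬ IsZero X) (n : ℕ) :
    ∃ Y : NilCat C, Y.obj.endo ^ n ≠ 0 := by
  induction n with
  | zero => exact ⟨(zeroFunctor C).obj X, fun h => hX ((IsZero.iff_id_eq_zero X).2 h)⟩
  | succ n ih =>
    obtain ⟨Y, hY⟩ := ih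
    exact ⟨double Y, fun h => double_endo_pow_ne_zero Y hY (pow_eq_zero_of_le (by omega) h)⟩

theorem not_isSemisimpleCat {X : C} (hX : ¬ IsZero X) : ¬ IsSemisimpleCat (NilCat C) := by
  intro h
  obtain ⟨Y, hY⟩ := exists_endo_pow_ne_zero hX 1
  obtain ⟨n, S, hS, ⟨e⟩⟩ := h Y
  have := Abelian.hasFiniteBiproducts (C := NilCat C)
  -- The endomorphism vanishes on simple objects, hence on their direct sums.
  have h0 : (selfNat C).app (biproduct S) = 0 := by
    refine biproduct.hom_ext' _ _ fun i => ?_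
    have := hS i
    refine ((selfNat C).naturality (biproduct.ι S i)).trans ?_
    rw [(selfNat_app_eq_zero_iff (S i)).2 (endo_eq_zero_of_simple (S i))]
    exact zero_comp.trans comp_zero.symm
  rw [pow_one, Ne, ← selfNat_app_eq_zero_iff] at hY
  apply hY
  have hnat := (selfNat C).naturality e.hom
  rw [h0, comp_zero] at hnat
  exact (cancel_mono e.hom).1 (hnat.symm.trans zero_comp.symm)

theorem not_allShortExactSplit {X : C} (hX : ¬ IsZero X) : ¬ AllShortExactSplit (NilCat C) := by
  intro h
  let Y : NilCat C := double ((zeroFunctor C).obj X)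
  let g : Y ⟶ Y := (selfNat C).app Y
  have hY : g ≠ 0 := by
    have := double_endo_pow_ne_zero ((zeroFunctor C).obj X) (n := 0)
      fun h => hX ((IsZero.iff_id_eq_zero X).2 h)
    rw [mul_zero, zero_add, pow_one, Ne, ← selfNat_app_eq_zero_iff] at this
    exact this
  have hY2 : g ≫ g = 0 := by
    have h2 : Y.obj.endo ^ 2 = 0 := by
      refine (double_endo_pow ((zeroFunctor C).obj X) 1).trans ?_
      rw [pow_one]
      exact biprod_map_zero
    rw [← selfNat_pow_app_eq_zero_iff, pow_two] at h2
    exact h2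
  obtain ⟨⟨r, t, -, -, hid⟩⟩ := h _ (ShortComplex.kernelImage_shortExact g)
  -- The endomorphism vanishes on both ends of the sequence, but not in the middle.
  have hK : (selfNat C).app (kernel g) = 0 := by
    rw [← cancel_mono (kernel.ι g), zero_comp]
    exact ((selfNat C).naturality (kernel.ι g)).symm.trans (kernel.condition g)
  have hI : (selfNat C).app (Abelian.image g) = 0 := by
    rw [← cancel_epi (Abelian.factorThruImage g), comp_zero]
    refine ((selfNat C).naturality (Abelian.factorThruImage g)).trans ?_
    rw [← cancel_mono (Abelian.image.ι g), zero_comp, ← hY2]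
    exact (Category.assoc _ _ _).trans (congrArg _ (Abelian.image.fac g))
  apply hY
  change Y ⟶ kernel g at r
  change Abelian.image g ⟶ Y at t
  have hr : g ≫ r = 0 := by
    refine ((selfNat C).naturality r).symm.trans ?_
    exact (congrArg (r ≫ ·) hK).trans comp_zero
  have hg : g ≫ Abelian.factorThruImage g = 0 := by
    refine ((selfNat C).naturality (Abelian.factorThruImage g)).symm.trans ?_
    rw [hI]
    exact comp_zero
  calc g = g ≫ 𝟙 Y := (Category.comp_id g).symm
    _ = g ≫ (r ≫ kernel.ι g + Abelian.factorThruImage g ≫ t) := congrArg (g ≫ ·) hid.symm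
    _ = 0 := by
      rw [Preadditive.comp_add, ← Category.assoc, ← Category.assoc, hr, hg, zero_comp, zero_comp,
        add_zero]

end

end NilCat

/-- A proper direct summand has an endomorphism algebra of smaller dimension. -/
theorem CategoryTheory.Linear.finrank_end_lt_of_retract {K : Type w} [Field K]
    {C : Type u} [Category.{v} C] [Preadditive C] [Linear K C] {Y Y₁ Y₂ : C}
    [FiniteDimensional K (Y ⟶ Y)] [FiniteDimensional K (Y₁ ⟶ Y₁)]
    {i : Y₁ ⟶ Y} {p : Y ⟶ Y₁} {j : Y₂ ⟶ Y} {q : Y ⟶ Y₂}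
    (hip : i ≫ p = 𝟙 _) (hjq : j ≫ q = 𝟙 _) (hjp : j ≫ p = 0) (h₂ : 𝟙 Y₂ ≠ 0) :
    Module.finrank K (Y₁ ⟶ Y₁) < Module.finrank K (Y ⟶ Y) := by
  let φ : (Y₁ ⟶ Y₁) →ₗ[K] (Y ⟶ Y) := Linear.leftComp K Y p ∘ₗ Linear.rightComp K Y₁ i
  have hφ : ∀ f, φ f = p ≫ f ≫ i := fun f => rfl
  have hinj : Function.Injective φ := by
    intro f g hfg
    have := congrArg (fun t => i ≫ t ≫ p) hfg
    simpa [hφ, hip, reassoc_of% hip] using this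
  refine lt_of_le_of_ne (LinearMap.finrank_le_finrank_of_injective hinj) fun heq => h₂ ?_
  -- Otherwise the endomorphism `q ≫ j` would factor through `p`.
  obtain ⟨f, hf⟩ := (LinearMap.injective_iff_surjective_of_finrank_eq_finrank heq).1 hinj (q ≫ j)
  have := congrArg (fun t => j ≫ t ≫ q) hf
  simpa [hφ, hjq, reassoc_of% hjp, reassoc_of% hjq] using this.symm

namespace NilCat

section

variable {K : Type w} [Field K] {C : Type u} [Category.{v} C] [Abelian C] [Linear K C]

/-- Among the objects with `y ^ n ≠ 0`, one with `End_C(Y)` of least dimension is indecomposable. -/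
theorem exists_indecomposable_endo_pow_ne_zero
    (hfin : ∀ X Y : C, FiniteDimensional K (X ⟶ Y)) {X : C} (hX : ¬ IsZero X) (n : ℕ) :
    ∃ Y : NilCat C, Indecomposable Y ∧ Y.obj.endo ^ n ≠ 0 := by
  classical
  have hex : ∃ (d : ℕ) (Y : NilCat C), Y.obj.endo ^ n ≠ 0 ∧
      Module.finrank K (Y.obj.obj ⟶ Y.obj.obj) = d := by
    obtain ⟨Y, hY⟩ := exists_endo_pow_ne_zero hX n
    exact ⟨_, Y, hY, rfl⟩
  obtain ⟨Y, hY, hd⟩ := Nat.find_spec hex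
  have hmin : ∀ Z : NilCat C, Z.obj.endo ^ n ≠ 0 →
      Module.finrank K (Y.obj.obj ⟶ Y.obj.obj) ≤ Module.finrank K (Z.obj.obj ⟶ Z.obj.obj) :=
    fun Z hZ => hd ▸ Nat.find_min' hex ⟨Z, hZ, rfl⟩
  -- By minimality, a summand with a nonzero complement is killed by the `n`-th power.
  have key : ∀ {Y₁ Y₂ : NilCat C} {i : Y₁ ⟶ Y} {p : Y ⟶ Y₁} {j : Y₂ ⟶ Y} {q : Y ⟶ Y₂},
      i ≫ p = 𝟙 _ → j ≫ q = 𝟙 _ → j ≫ p = 0 → ¬ IsZero Y₂ →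
        NatTrans.app (selfNat C ^ n) Y₁ = 0 := by
    intro Y₁ Y₂ i p j q hip hjq hjp h₂
    by_contra h
    have := hfin
    refine (hmin Y₁ (mt (selfNat_pow_app_eq_zero_iff Y₁ n).2 h)).not_gt ?_
    refine Linear.finrank_end_lt_of_retract (K := K)
      (i := (forget C).map i) (p := (forget C).map p) (j := (forget C).map j)
      (q := (forget C).map q) ?_ ?_ ?_ ?_
    · exact congrArg (fun f => (forget C).map f) hip
    · exact congrArg (fun f => (forget C).map f) hjq
    · exact congrArg (fun f => (forget C).map f) hjp
    · rwa [isZero_iff, IsZero.iff_id_eq_zero] at h₂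
  refine ⟨Y, ⟨fun h => hY ?_, fun Y₁ Y₂ e => ?_⟩, hY⟩
  · exact ((isZero_iff Y).1 h).eq_of_src _ _
  by_contra! h
  have h₁ : NatTrans.app (selfNat C ^ n) Y₁ = 0 :=
    key (i := biprod.inl ≫ e.inv) (p := e.hom ≫ biprod.fst) (j := biprod.inr ≫ e.inv)
      (q := e.hom ≫ biprod.snd) (by simp) (by simp) (by simp) h.2
  have h₂ : NatTrans.app (selfNat C ^ n) Y₂ = 0 :=
    key (i := biprod.inr ≫ e.inv) (p := e.hom ≫ biprod.snd) (j := biprod.inl ≫ e.inv)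
      (q := e.hom ≫ biprod.fst) (by simp) (by simp) (by simp) h.1
  have h₁₂ : NatTrans.app (selfNat C ^ n) (Y₁ ⊞ Y₂) = 0 := by
    refine biprod.hom_ext' _ _ ?_ ?_
    · refine ((selfNat C ^ n : CategoryTheory.End _).naturality biprod.inl).trans ?_
      rw [h₁]
      exact zero_comp.trans comp_zero.symm
    · refine ((selfNat C ^ n : CategoryTheory.End _).naturality biprod.inr).trans ?_
      rw [h₂]
      exact zero_comp.trans comp_zero.symm
  have hnat := NatTrans.naturality (selfNat C ^ n) e.hom
  rw [h₁₂, comp_zero] at hnat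
  exact hY ((selfNat_pow_app_eq_zero_iff Y n).1
    ((cancel_mono e.hom).1 (hnat.symm.trans zero_comp.symm)))

theorem isOfInfiniteRepType (hfin : ∀ X Y : C, FiniteDimensional K (X ⟶ Y)) {X : C}
    (hX : ¬ IsZero X) : IsOfInfiniteRepType (NilCat C) := by
  intro hS
  -- The nilpotency index is bounded on each isomorphism class.
  have hN : ∀ c : Quotient (isIsomorphicSetoid (NilCat C)), ∃ N : ℕ, ∀ Y : NilCat C,
      Quotient.mk _ Y = c → NatTrans.app (selfNat C ^ N) Y = 0 := by
    refine Quotient.ind fun Z => ?_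
    obtain ⟨N, hN⟩ := Z.property
    refine ⟨N, fun Y hY => ?_⟩
    obtain ⟨e⟩ := Quotient.exact hY
    have hnat := NatTrans.naturality (selfNat C ^ N) e.hom
    rw [(selfNat_pow_app_eq_zero_iff Z N).2 hN, comp_zero] at hnat
    exact (cancel_mono e.hom).1 (hnat.symm.trans zero_comp.symm)
  choose N hN using hN
  obtain ⟨M, hM⟩ := (hS.image N).bddAbove
  obtain ⟨Y, hY, hYM⟩ := exists_indecomposable_endo_pow_ne_zero hfin hX M
  have h0 := (selfNat_pow_app_eq_zero_iff Y _).1 (hN _ Y rfl)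
  exact hYM (pow_eq_zero_of_le (hM ⟨_, ⟨Y, hY, rfl⟩, rfl⟩) h0)

end

end NilCat

/-! ### The Grothendieck group of the nilpotent category -/

namespace NilCat

section

variable {C : Type u} [Category.{v} C] [Abelian C]

instance : (zeroFunctor C).Additive where
  map_add := rfl

theorem map_zeroFunctor_shortExact (S : ShortComplex C) (hS : S.ShortExact) :
    (S.map (zeroFunctor C)).ShortExact :=
  ShortComplex.ShortExact.of_map (forget C) hS

/-- The forgetful functor splits `K₀(C) ⟶ K₀(Nil(C))`, and dévissage along powers of the nilpotent
endomorphism shows that the classes of the objects `(Y, 0)` generate. -/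
theorem bijective_map_zeroFunctor :
    Function.Bijective (K0.map (zeroFunctor C) map_zeroFunctor_shortExact) := by
  constructor
  · have hcomp : (K0.map (forget C) fun _ hS => hS.map_of_exact _).comp
        (K0.map (zeroFunctor C) map_zeroFunctor_shortExact) = AddMonoidHom.id _ := by
      ext X
      rfl
    exact Function.LeftInverse.injective (DFunLike.congr_fun hcomp)
  · rw [← AddMonoidHom.range_eq_top]
    refine K0.eq_top_of_cls_mem fun X => ?_
    obtain ⟨n, hn⟩ := X.property
    refine K0.cls_mem_of_prod_app_eq_zero (fun _ : Unit => selfNat C) _ ?_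
      (List.replicate n ()) X ?_
    · rintro - ⟨⟨Y, y⟩, hy⟩ h
      obtain rfl : y = 0 := (selfNat_app_eq_zero_iff _).1 h
      exact ⟨K0.cls Y, K0.map_cls _ _ _⟩
    · rw [List.map_replicate, List.prod_replicate]
      exact (selfNat_pow_app_eq_zero_iff X n).2 hn

end

end NilCat

/-! ### Fitting idempotents -/

/-- `e` is the Fitting idempotent of `a`: it commutes with `a`, and `a` is nilpotent on the part cut
out by `e` and invertible on the part cut out by `1 - e`. -/
structure IsFittingIdempotent {R : Type*} [Ring R] (a e : R) : Prop where
  idem : e * e = e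
  pow_mul : ∃ n : ℕ, a ^ n * e = 0
  exists_inv : ∃ b : R, b * a = 1 - e ∧ a * b = 1 - e

namespace IsFittingIdempotent

variable {R : Type*} [Ring R] {a e : R}

theorem commute (h : IsFittingIdempotent a e) : a * e = e * a := by
  obtain ⟨b, hba, hab⟩ := h.exists_inv
  have : a * (1 - e) = (1 - e) * a := by rw [← hba, ← mul_assoc, hab, hba]
  simpa [mul_sub, sub_mul] using this

theorem of_isNilpotent (h : IsNilpotent a) : IsFittingIdempotent a 1 :=
  ⟨one_mul 1, h.imp fun _ hn => by rw [hn, zero_mul], 0, by simp⟩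

theorem of_isUnit (h : IsUnit a) : IsFittingIdempotent a 0 :=
  ⟨mul_zero 0, ⟨0, mul_zero _⟩, h.unit⁻¹.val, by simp⟩

theorem exists_pow_inv (h : IsFittingIdempotent a e) (n : ℕ) :
    ∃ b : R, b * a ^ n = 1 - e ∧ a ^ n * b = 1 - e := by
  have hsq : (1 - e) * (1 - e) = 1 - e := by simp [mul_sub, sub_mul, h.idem]
  have hcomm : Commute a (1 - e) := (Commute.one_right a).sub_right h.commute
  obtain ⟨b, hba, hab⟩ := h.exists_inv
  induction n with
  | zero => exact ⟨1 - e, by simp⟩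
  | succ n ih =>
    obtain ⟨c, hca, hac⟩ := ih
    refine ⟨c * b, ?_, ?_⟩
    · rw [pow_succ', mul_assoc c, ← mul_assoc b, hba, ← (hcomm.pow_left n).eq,
        ← mul_assoc, hca, hsq]
    · rw [pow_succ', mul_assoc a, ← mul_assoc _ c, hac, ← mul_assoc, hcomm.eq, mul_assoc, hab, hsq]

/-- Fitting idempotents exist for algebraic elements: if `X ^ n * q` is the minimal polynomial of
`a` and `q` is prime to `X`, take `e = (s * q) (a)` where `r * X ^ (n + 1) + s * q = 1`. -/
theorem exists_of_isIntegral {K : Type*} [Field K] [Algebra K R] (ha : IsIntegral K a) :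
    ∃ e : R, IsFittingIdempotent a e := by
  open Polynomial in
  obtain ⟨q, hp, hq⟩ := exists_eq_pow_rootMultiplicity_mul_and_not_dvd (minpoly K a)
    (minpoly.ne_zero ha) 0
  rw [C_0, sub_zero] at hp hq
  generalize rootMultiplicity 0 (minpoly K a) = n at hp
  obtain ⟨r, s, hrs⟩ : IsCoprime (X ^ (n + 1)) q :=
    ((prime_X.irreducible.coprime_iff_not_dvd).2 hq).pow_left
  have h0 : ∀ t : K[X], aeval a (t * (X ^ n * q)) = 0 := fun t => by
    rw [map_mul, ← hp, minpoly.aeval, mul_zero]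
  have h1 : 1 - aeval a (s * q) = aeval a (r * X ^ (n + 1)) := by
    rw [sub_eq_iff_eq_add, ← map_add, hrs, map_one]
  have hX : aeval a (X : K[X]) = a := aeval_X a
  refine ⟨aeval a (s * q), ?_, ⟨n, ?_⟩, aeval a (r * X ^ n), ?_, ?_⟩
  · have h2 : (1 - aeval a (s * q)) * aeval a (s * q) = 0 := by
      rw [h1, ← map_mul, ← h0 (r * X * s)]
      congr 1
      ring
    rw [sub_mul, one_mul, sub_eq_zero] at h2
    exact h2.symm
  · calc a ^ n * aeval a (s * q) = aeval a (X ^ n * (s * q)) := by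
          rw [map_mul _ (X ^ n), map_pow, hX]
      _ = aeval a (s * (X ^ n * q)) := by congr 1; ring
      _ = 0 := h0 s
  · calc aeval a (r * X ^ n) * a = aeval a (r * X ^ n * X) := by rw [map_mul _ _ X, hX]
      _ = 1 - aeval a (s * q) := by rw [h1]; congr 1; ring
  · calc a * aeval a (r * X ^ n) = aeval a (X * (r * X ^ n)) := by rw [map_mul _ X, hX]
      _ = 1 - aeval a (s * q) := by rw [h1]; congr 1; ring

/-- Fitting idempotents are natural: a morphism that intertwines two endomorphisms intertwines their
Fitting idempotents. -/
theorem naturality {C : Type u} [Category.{v} C] [Preadditive C] {X Y : C}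
    {a e : CategoryTheory.End X} {a' e' : CategoryTheory.End Y} (h : IsFittingIdempotent a e)
    (h' : IsFittingIdempotent a' e') (f : X ⟶ Y)
    (hf : (a : X ⟶ X) ≫ f = f ≫ (a' : Y ⟶ Y)) : (e : X ⟶ X) ≫ f = f ≫ (e' : Y ⟶ Y) := by
  have hpow : ∀ n : ℕ, (a ^ n : CategoryTheory.End X) ≫ f = f ≫ (a' ^ n : CategoryTheory.End Y) :=
    fun n => by
      have h := congrArg EndCat.Hom.f
        (EndCat.self_pow_naturality (X := ⟨X, a⟩) (Y := ⟨Y, a'⟩) ⟨f, hf⟩ n)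
      rw [EndCat.comp_f, EndCat.comp_f, EndCat.pow_f, EndCat.pow_f] at h
      exact h
  have h1 : (e : X ⟶ X) ≫ f ≫ (1 - e' : CategoryTheory.End Y) = 0 := by
    obtain ⟨n, hn⟩ := h.pow_mul
    obtain ⟨b, hb, -⟩ := h'.exists_pow_inv n
    rw [End.mul_def] at hn hb
    rw [← hb, ← Category.assoc f, ← hpow, Category.assoc, ← Category.assoc, hn]
    exact zero_comp
  have h2 : (1 - e : CategoryTheory.End X) ≫ f ≫ (e' : Y ⟶ Y) = 0 := by
    obtain ⟨n, hn⟩ := h'.pow_mul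
    obtain ⟨b, -, hb⟩ := h.exists_pow_inv n
    rw [(Commute.pow_left h'.commute n : _ = _), End.mul_def] at hn
    rw [End.mul_def] at hb
    rw [← hb, Category.assoc, ← Category.assoc _ f, hpow, Category.assoc, hn]
    exact (congrArg (fun t => b ≫ t) comp_zero).trans comp_zero
  have h3 : f ≫ (1 - e' : CategoryTheory.End Y) = f - f ≫ (e' : Y ⟶ Y) :=
    (Preadditive.comp_sub f (𝟙 Y) e').trans (by rw [Category.comp_id])
  have h4 : (1 - e : CategoryTheory.End X) ≫ f ≫ (e' : Y ⟶ Y) =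
      f ≫ (e' : Y ⟶ Y) - (e : X ⟶ X) ≫ f ≫ (e' : Y ⟶ Y) :=
    (Preadditive.sub_comp (𝟙 X) e (f ≫ e')).trans (by rw [Category.id_comp])
  rw [h3, Preadditive.comp_sub, sub_eq_zero] at h1
  rw [h4, sub_eq_zero] at h2
  exact h1.trans h2.symm

theorem unique {C : Type u} [Category.{v} C] [Preadditive C] {X : C}
    {a e e' : CategoryTheory.End X} (h : IsFittingIdempotent a e) (h' : IsFittingIdempotent a e') :
    e = e' := by
  have := h.naturality h' (𝟙 X) ((Category.comp_id _).trans (Category.id_comp _).symm)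
  rwa [Category.comp_id, Category.id_comp] at this

end IsFittingIdempotent

/-! ### Generalized eigenspaces -/

namespace EndCat

section

variable {K : Type w} [Field K] {C : Type u} [Category.{v} C] [Abelian C] [Linear K C]

theorem algebraMap_comm {X Y : C} (k : K) (f : X ⟶ Y) :
    (algebraMap K (CategoryTheory.End X) k : X ⟶ X) ≫ f =
      f ≫ (algebraMap K (CategoryTheory.End Y) k : Y ⟶ Y) := by
  rw [Algebra.algebraMap_eq_smul_one, Algebra.algebraMap_eq_smul_one]
  refine (Linear.smul_comp _ _ _ k (𝟙 X) f).trans ?_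
  refine Eq.trans ?_ (Linear.comp_smul _ _ _ f k (𝟙 Y)).symm
  rw [Category.id_comp, Category.comp_id]

/-- A morphism in `End(C)` also intertwines the shifted endomorphisms `x - k`. -/
theorem sub_algebraMap_comm {X Y : EndCat C} (k : K) (g : X ⟶ Y) :
    (X.endo - algebraMap K (CategoryTheory.End X.obj) k : CategoryTheory.End X.obj) ≫ g.f =
      g.f ≫ (Y.endo - algebraMap K (CategoryTheory.End Y.obj) k : CategoryTheory.End Y.obj) := by
  refine (Preadditive.sub_comp _ _ _).trans (Eq.trans ?_ (Preadditive.comp_sub _ _ _).symm)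
  rw [g.comm, algebraMap_comm]

/-- The endomorphism `x - k` of the objects `(X, x)`, as an endomorphism of the identity functor. -/
def selfSub (k : K) : CategoryTheory.End (𝟭 (EndCat C)) where
  app X := ⟨X.endo - algebraMap K (CategoryTheory.End X.obj) k, (sub_algebraMap_comm k X.self).symm⟩
  naturality _ _ g := hom_ext (sub_algebraMap_comm k g).symm

theorem prod_selfSub_app_f (l : List K) (X : EndCat C) :
    (NatTrans.app (l.map (selfSub (C := C))).prod X).f =
      (l.map fun k => X.endo - algebraMap K (CategoryTheory.End X.obj) k).prod := by
  induction l with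
  | nil => rfl
  | cons k l ih =>
    rw [List.map_cons, List.prod_cons, List.map_cons, List.prod_cons, End.mul_def, End.mul_def,
      ← ih]
    rfl

/-- The functor `X ↦ (X, k)`. -/
def scalarFunctor (k : K) : C ⥤ EndCat C where
  obj X := ⟨X, algebraMap K (CategoryTheory.End X) k⟩
  map f := ⟨f, algebraMap_comm k f⟩

instance (k : K) : (scalarFunctor (C := C) k).Additive where
  map_add := rfl

theorem map_scalarFunctor_shortExact (k : K) (S : ShortComplex C) (hS : S.ShortExact) :
    (S.map (scalarFunctor k)).ShortExact :=
  ShortComplex.ShortExact.of_map (forget C) hS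

/-- The minimal polynomial of `x` splits, so a product of endomorphisms `x - k` vanishes. -/
theorem exists_list_prod_eq_zero [IsAlgClosed K] (X : EndCat C)
    [FiniteDimensional K (X.obj ⟶ X.obj)] :
    ∃ l : List K, (l.map fun k => X.endo - algebraMap K (CategoryTheory.End X.obj) k).prod = 0 := by
  have : FiniteDimensional K (CategoryTheory.End X.obj) := ‹_›
  have hX := IsIntegral.of_finite K X.endo
  refine ⟨(minpoly K X.endo).roots.toList, ?_⟩
  have h := minpoly.aeval K X.endo
  rw [(IsAlgClosed.splits (minpoly K X.endo)).eq_prod_roots_of_monic (minpoly.monic hX),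
    ← Multiset.coe_toList (minpoly K X.endo).roots, Multiset.map_coe, Multiset.prod_coe,
    map_list_prod, List.map_map] at h
  simpa [Function.comp_def] using h

theorem exists_eigen (hfin : ∀ X Y : C, FiniteDimensional K (X ⟶ Y)) (k : K) (X : EndCat C) :
    ∃ (Y : C) (i : Y ⟶ X.obj) (r : X.obj ⟶ Y), i ≫ r = 𝟙 Y ∧
      IsFittingIdempotent (R := CategoryTheory.End X.obj)
        (X.endo - algebraMap K (CategoryTheory.End X.obj) k) (r ≫ i) := by
  have : FiniteDimensional K (CategoryTheory.End X.obj) := hfin _ _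
  obtain ⟨e, he⟩ := IsFittingIdempotent.exists_of_isIntegral
    (IsIntegral.of_finite K (X.endo - algebraMap K (CategoryTheory.End X.obj) k))
  obtain ⟨Y, i, r, hir, hri⟩ := IsIdempotentComplete.idempotents_split X.obj e he.idem
  exact ⟨Y, i, r, hir, by rwa [hri]⟩

/-- The generalized eigenspace of `(X, x)` for the eigenvalue `k`: the image of the Fitting
idempotent of `x - k`. -/
noncomputable def eigen (hfin : ∀ X Y : C, FiniteDimensional K (X ⟶ Y)) (k : K)
    (X : EndCat C) : C :=
  (exists_eigen hfin k X).choose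

section Eigen

variable (hfin : ∀ X Y : C, FiniteDimensional K (X ⟶ Y)) (k : K)

/-- The inclusion of the generalized eigenspace. -/
noncomputable def eigenι (X : EndCat C) : eigen hfin k X ⟶ X.obj :=
  (exists_eigen hfin k X).choose_spec.choose

/-- The projection onto the generalized eigenspace. -/
noncomputable def eigenπ (X : EndCat C) : X.obj ⟶ eigen hfin k X :=
  (exists_eigen hfin k X).choose_spec.choose_spec.choose

@[simp]
theorem eigenι_eigenπ (X : EndCat C) : eigenι hfin k X ≫ eigenπ hfin k X = 𝟙 _ :=
  (exists_eigen hfin k X).choose_spec.choose_spec.choose_spec.1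

@[simp]
theorem eigenι_eigenπ_assoc (X : EndCat C) {Y : C} (f : eigen hfin k X ⟶ Y) :
    eigenι hfin k X ≫ eigenπ hfin k X ≫ f = f := by
  rw [← Category.assoc, eigenι_eigenπ, Category.id_comp]

theorem isFittingIdempotent_eigen (X : EndCat C) :
    IsFittingIdempotent (R := CategoryTheory.End X.obj)
      (X.endo - algebraMap K (CategoryTheory.End X.obj) k) (eigenπ hfin k X ≫ eigenι hfin k X) :=
  (exists_eigen hfin k X).choose_spec.choose_spec.choose_spec.2

theorem eigen_idem_naturality {X Y : EndCat C} (g : X ⟶ Y) :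
    (eigenπ hfin k X ≫ eigenι hfin k X) ≫ g.f = g.f ≫ eigenπ hfin k Y ≫ eigenι hfin k Y :=
  (isFittingIdempotent_eigen hfin k X).naturality (isFittingIdempotent_eigen hfin k Y) g.f
    (sub_algebraMap_comm k g)

/-- The generalized eigenspace, as a functor. -/
noncomputable def eigenFunctor : EndCat C ⥤ C where
  obj := eigen hfin k
  map {X Y} g := eigenι hfin k X ≫ g.f ≫ eigenπ hfin k Y
  map_id X := by simp
  map_comp {X Y Z} g h := by
    have := eigen_idem_naturality hfin k h
    simp only [Category.assoc] at this
    simp [reassoc_of% this]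

instance : (eigenFunctor hfin k).Additive where
  map_add {X Y f g} := by
    have : eigenι hfin k X ≫ (f.f + g.f) ≫ eigenπ hfin k Y =
        eigenι hfin k X ≫ f.f ≫ eigenπ hfin k Y + eigenι hfin k X ≫ g.f ≫ eigenπ hfin k Y := by
      rw [Preadditive.add_comp, Preadditive.comp_add]
    exact this

/-- Taking generalized eigenspaces is exact, being a retract of the forgetful functor. -/
theorem map_eigenFunctor_shortExact (S : ShortComplex (EndCat C)) (hS : S.ShortExact) :
    (S.map (eigenFunctor hfin k)).ShortExact := by
  have hι : ∀ {X Y : EndCat C} (g : X ⟶ Y), eigenι hfin k X ≫ g.f =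
      (eigenι hfin k X ≫ g.f ≫ eigenπ hfin k Y) ≫ eigenι hfin k Y := fun {X Y} g => by
    have := eigen_idem_naturality hfin k g
    simp only [Category.assoc] at this
    simp [← this]
  have hπ : ∀ {X Y : EndCat C} (g : X ⟶ Y), eigenπ hfin k X ≫
      (eigenι hfin k X ≫ g.f ≫ eigenπ hfin k Y) = g.f ≫ eigenπ hfin k Y := fun {X Y} g => by
    have := eigen_idem_naturality hfin k g
    simp only [Category.assoc] at this
    simp [reassoc_of% this]
  refine ShortComplex.ShortExact.of_retract ⟨?_, ?_, ?_⟩ (hS.map_of_exact (forget C))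
  · exact ⟨eigenι hfin k S.X₁, eigenι hfin k S.X₂, eigenι hfin k S.X₃, hι S.f, hι S.g⟩
  · exact ⟨eigenπ hfin k S.X₁, eigenπ hfin k S.X₂, eigenπ hfin k S.X₃, hπ S.f, hπ S.g⟩
  · ext
    · exact eigenι_eigenπ hfin k S.X₁
    · exact eigenι_eigenπ hfin k S.X₂
    · exact eigenι_eigenπ hfin k S.X₃

theorem isFittingIdempotent_eigen_scalar (k l : K) (X : C) :
    IsFittingIdempotent (R := CategoryTheory.End X) (algebraMap K (CategoryTheory.End X) (l - k))
      (eigenπ hfin k ((scalarFunctor l).obj X) ≫ eigenι hfin k ((scalarFunctor l).obj X)) := by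
  rw [map_sub]
  exact isFittingIdempotent_eigen hfin k ((scalarFunctor l).obj X)

/-- The object `(X, k)` is its own generalized eigenspace for the eigenvalue `k`. -/
noncomputable def eigenScalarIso (X : C) : eigen hfin k ((scalarFunctor k).obj X) ≅ X where
  hom := eigenι hfin k ((scalarFunctor k).obj X)
  inv := eigenπ hfin k ((scalarFunctor k).obj X)
  hom_inv_id := eigenι_eigenπ hfin k _
  inv_hom_id := (isFittingIdempotent_eigen_scalar hfin k k X).unique
    (.of_isNilpotent (by rw [sub_self, map_zero]; exact .zero))

theorem isZero_eigen_scalar {k l : K} (hkl : k ≠ l) (X : C) :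
    IsZero (eigen hfin k ((scalarFunctor l).obj X)) := by
  have h : eigenπ hfin k ((scalarFunctor l).obj X) ≫ eigenι hfin k ((scalarFunctor l).obj X) = 0 :=
    (isFittingIdempotent_eigen_scalar hfin k l X).unique
      (.of_isUnit ((IsUnit.mk0 _ (sub_ne_zero.2 hkl.symm)).map _))
  have hid : ∀ {Y Z : C} {i : Y ⟶ Z} {r : Z ⟶ Y}, i ≫ r = 𝟙 Y → r ≫ i = 0 → 𝟙 Y = 0 :=
    fun {Y Z i r} hir hri => by
      rw [← Category.comp_id (𝟙 Y), ← hir, Category.assoc, ← Category.assoc r, hri, zero_comp,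
        comp_zero]
  exact (IsZero.iff_id_eq_zero _).2 (hid (eigenι_eigenπ hfin k _) h)

end Eigen

/-- The homomorphism `⨁ₖ K₀(C) ⟶ K₀(End(C))` given by `[X] ↦ [(X, k)]` on the summand of `k`. -/
noncomputable def sumScalar [DecidableEq K] : DirectSum K (fun _ => K0 C) →+ K0 (EndCat C) :=
  DirectSum.toAddMonoid fun k => K0.map (scalarFunctor k) (map_scalarFunctor_shortExact k)

/-- Injectivity comes from the generalized eigenspaces; surjectivity from dévissage along the linear
factors of an annihilating polynomial of `x`. -/
theorem bijective_sumScalar [DecidableEq K] [IsAlgClosed K]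
    (hfin : ∀ X Y : C, FiniteDimensional K (X ⟶ Y)) :
    Function.Bijective (sumScalar (K := K) (C := C)) := by
  constructor
  · -- Generalized eigenspaces recover the components.
    have key : ∀ k, (K0.map (eigenFunctor hfin k) (map_eigenFunctor_shortExact hfin k)).comp
        sumScalar = DFinsupp.evalAddMonoidHom k := by
      intro k
      refine DirectSum.addHom_ext' fun l => K0.hom_ext fun X => ?_
      have h1 : sumScalar (K := K) (DirectSum.of (fun _ => K0 C) l (K0.cls X)) =
          K0.cls ((scalarFunctor l).obj X) := by
        rw [sumScalar, DirectSum.toAddMonoid_of, K0.map_cls]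
      change K0.map _ (map_eigenFunctor_shortExact hfin k) (sumScalar _) =
        DirectSum.of (fun _ : K => K0 C) l (K0.cls X) k
      rw [h1, K0.map_cls]
      by_cases hkl : k = l
      · subst hkl
        rw [DirectSum.of_eq_same]
        exact K0.cls_eq_of_iso (eigenScalarIso hfin k X)
      · rw [DirectSum.of_eq_of_ne _ _ _ hkl]
        exact K0.cls_eq_zero (isZero_eigen_scalar hfin hkl X)
    intro s t hst
    refine DFinsupp.ext fun k => ?_
    have hs := DFunLike.congr_fun (key k) s
    have ht := DFunLike.congr_fun (key k) t
    exact hs.symm.trans ((congrArg _ hst).trans ht)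
  · rw [← AddMonoidHom.range_eq_top]
    refine K0.eq_top_of_cls_mem fun X => ?_
    have := hfin X.obj X.obj
    obtain ⟨l, hl⟩ := exists_list_prod_eq_zero (K := K) X
    refine K0.cls_mem_of_prod_app_eq_zero (selfSub (C := C)) _ ?_ l X
      (hom_ext ((prod_selfSub_app_f l X).trans hl))
    rintro k ⟨Y, y⟩ h
    obtain rfl : y = algebraMap K (CategoryTheory.End Y) k :=
      sub_eq_zero.1 (congrArg Hom.f h)
    refine ⟨DirectSum.of (fun _ => K0 C) k (K0.cls Y), ?_⟩
    rw [sumScalar, DirectSum.toAddMonoid_of, K0.map_cls]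
    rfl

end

end EndCat

theorem mainTheorem3 {K : Type w} [Field K] [IsAlgClosed K]
    {C : Type u} [Category.{v} C] [Abelian C] [Linear K C]
    (hHomFinite : ∀ X Y : C, FiniteDimensional K (X ⟶ Y))
    (hKrullSchmidt : IsKrullSchmidt C)
    (hNontrivial : ∃ X : C, ¬ IsZero X)
    (hFiniteRank : Module.rank ℤ (K0 C) < Cardinal.aleph0) :
    (¬ IsSemisimpleCat (NilCat C) ∧ ¬ AllShortExactSplit (NilCat C) ∧
        IsOfInfiniteRepType (NilCat C)) ∧
      ((∀ X : NilCat C, Simple X ↔ Simple X.obj.obj ∧ X.obj.endo = 0) ∧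
        ∃ Φ : (simpleObjects C).FullSubcategory ⥤ (simpleObjects (NilCat C)).FullSubcategory,
          Φ ⋙ (simpleObjects (NilCat C)).ι = (simpleObjects C).ι ⋙ NilCat.zeroFunctor C ∧
            IsCatIso Φ) ∧
      Nonempty (K0 (NilCat C) ≃+ K0 C) ∧
      Nonempty (K0 (EndCat C) ≃+ DirectSum K (fun _ => K0 C)) := by
  classical
  obtain ⟨X, hX⟩ := hNontrivial
  exact ⟨⟨NilCat.not_isSemisimpleCat hX, NilCat.not_allShortExactSplit hX,
      NilCat.isOfInfiniteRepType hHomFinite hX⟩,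
    ⟨NilCat.simple_iff, NilCat.simpleFunctor C, rfl, NilCat.isCatIso_simpleFunctor⟩,
    ⟨(AddEquiv.ofBijective _ NilCat.bijective_map_zeroFunctor).symm⟩,
    ⟨(AddEquiv.ofBijective _ (EndCat.bijective_sumScalar hHomFinite)).symm⟩⟩
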